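/- Work in the first-order language $\{0,S,+,\times,\leqslant\}$ of arithmetic and fix a standard Gödel numbering of its formulas. Let $\Sigma_0=\Pi_0$ be the class of bounded formulas (every quantifier has the form $\forall x\,(x\leqslant t\to\cdots)$ or $\exists x\,(x\leqslant t\wedge\cdots)$ with $x$ not occurring in the term $t$); for each $n\in\mathbb{N}$, let $\Sigma_{n+1}$ be obtained from $\Pi_n$ by closing under existential quantifiers, bounded quantifiers, conjunction and disjunction, let $\Pi_{n+1}$ be obtained from $\Sigma_n$ by closing under universal quantifiers, bounded quantifiers, conjunction and disjunction, the negation of a $\Sigma_{n+1}$-formula counting as a $\Pi_{n+1}$-formula and vice versa. For a class $\Gamma$ of formulas, a theory given by a set $T$ of sentences (its axioms) is called $\Gamma$-definable if there is a formula $A(x)\in\Gamma$, with $x$ as its only free variable, such that $\{m\in\mathbb{N} : \mathbb{N}\models A(m)\}$ is exactly the set of Gödel numbers of the members of $T$. Two theories are called equivalent if they have the same logical consequences. \textbf{Lemma.} For every $n\in\mathbb{N}$ (including $n=0$), every $\Sigma_{n+1}$-definable theory $T$ is equivalent to some $\Pi_n$-definable theory $T'$. -/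

import Mathlib

open FirstOrder FirstOrder.Language

namespace Arithmetic

/-- The function symbols `0`, `S`, `+`, `×` of the language of arithmetic. -/
inductive Func : ℕ → Type
  | zero : Func 0
  | succ : Func 1
  | add : Func 2
  | mul : Func 2

/-- The relation symbol `≤` of the language of arithmetic (equality is a logical symbol). -/
inductive Rel : ℕ → Type
  | le : Rel 2

/-- The first-order language `{0, S, +, ×, ≤}` of arithmetic. -/
def arith : FirstOrder.Language.{0, 0} where
  Functions := Func
  Relations := Rel

/-- The standard model. -/
instance standardModel : arith.Structure ℕ where
  funMap := fun {_} f =>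
    match f with
    | Func.zero => fun _ => 0
    | Func.succ => fun v => v 0 + 1
    | Func.add => fun v => v 0 + v 1
    | Func.mul => fun v => v 0 * v 1
  RelMap := fun {_} r =>
    match r with
    | Rel.le => fun v => v 0 ≤ v 1

/-! ### The arithmetical hierarchy of formulas -/

/-- The atomic formula `t ≤ s`. -/
def leFormula {α : Type} {m : ℕ} (t s : arith.Term (α ⊕ Fin m)) : arith.BoundedFormula α m :=
  BoundedFormula.rel (Rel.le : arith.Relations 2) ![t, s]

/-- The formula `x ≤ t` where `x` is the last of `m + 1` bound variables, and `t` is a term in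
which `x` does not occur. -/
def lastLe {α : Type} {m : ℕ} (t : arith.Term (α ⊕ Fin m)) : arith.BoundedFormula α (m + 1) :=
  leFormula (Term.var (Sum.inr (Fin.last m))) (t.relabel (Sum.map id Fin.castSucc))

/-- The bounded universal quantification `∀ x (x ≤ t → φ)`. -/
def ballLe {α : Type} {m : ℕ} (t : arith.Term (α ⊕ Fin m))
    (φ : arith.BoundedFormula α (m + 1)) : arith.BoundedFormula α m :=
  ((lastLe t).imp φ).all

/-- The bounded existential quantification `∃ x (x ≤ t ∧ φ)`. -/
def bexLe {α : Type} {m : ℕ} (t : arith.Term (α ⊕ Fin m))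
    (φ : arith.BoundedFormula α (m + 1)) : arith.BoundedFormula α m :=
  (lastLe t ⊓ φ).ex

/-- Bounded formulas: all quantifiers are bounded. (Negation, conjunction and disjunction are
abbreviations in terms of `→` and `⊥`.) -/
inductive IsBounded {α : Type} : {m : ℕ} → arith.BoundedFormula α m → Prop
  | falsum {m : ℕ} : IsBounded (BoundedFormula.falsum : arith.BoundedFormula α m)
  | equal {m : ℕ} (t s : arith.Term (α ⊕ Fin m)) : IsBounded (BoundedFormula.equal t s)
  | le {m : ℕ} (t s : arith.Term (α ⊕ Fin m)) : IsBounded (leFormula t s)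
  | imp {m : ℕ} {φ ψ : arith.BoundedFormula α m} :
      IsBounded φ → IsBounded ψ → IsBounded (φ.imp ψ)
  | ball {m : ℕ} (t : arith.Term (α ⊕ Fin m)) {φ : arith.BoundedFormula α (m + 1)} :
      IsBounded φ → IsBounded (ballLe t φ)
  | bex {m : ℕ} (t : arith.Term (α ⊕ Fin m)) {φ : arith.BoundedFormula α (m + 1)} :
      IsBounded φ → IsBounded (bexLe t φ)

/-- The two sides of the arithmetical hierarchy. -/
inductive Side
  | sigma
  | pi

/-- The opposite side. -/
def Side.dual : Side → Side
  | .sigma => .pi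
  | .pi => .sigma

/-- The arithmetical hierarchy: `InHierarchy .sigma n φ` says that `φ` is a `Σₙ`-formula, and
`InHierarchy .pi n φ` that it is a `Πₙ`-formula.

`Σ₀ = Π₀` is the class of bounded formulas. `Σₙ₊₁` contains `Πₙ` and is closed under
existential quantifiers, bounded quantifiers, and the connectives (negation exchanges `Σₙ₊₁` and
`Πₙ₊₁`, and the rule `imp` yields the rules for negation, conjunction and disjunction, see below);
`Πₙ₊₁` is dual. -/
inductive InHierarchy {α : Type} :
    Side → ℕ → {m : ℕ} → arith.BoundedFormula α m → Prop
  | bounded {Γ : Side} {m : ℕ} {φ : arith.BoundedFormula α m} :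
      IsBounded φ → InHierarchy Γ 0 φ
  | step {Γ : Side} {n m : ℕ} {φ : arith.BoundedFormula α m} :
      InHierarchy Γ.dual n φ → InHierarchy Γ (n + 1) φ
  | imp {Γ : Side} {n m : ℕ} {φ ψ : arith.BoundedFormula α m} :
      InHierarchy Γ.dual (n + 1) φ → InHierarchy Γ (n + 1) ψ → InHierarchy Γ (n + 1) (φ.imp ψ)
  | ball {Γ : Side} {n m : ℕ} (t : arith.Term (α ⊕ Fin m)) {φ : arith.BoundedFormula α (m + 1)} :
      InHierarchy Γ (n + 1) φ → InHierarchy Γ (n + 1) (ballLe t φ)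
  | bex {Γ : Side} {n m : ℕ} (t : arith.Term (α ⊕ Fin m)) {φ : arith.BoundedFormula α (m + 1)} :
      InHierarchy Γ (n + 1) φ → InHierarchy Γ (n + 1) (bexLe t φ)
  | ex {n m : ℕ} {φ : arith.BoundedFormula α (m + 1)} :
      InHierarchy .sigma (n + 1) φ → InHierarchy .sigma (n + 1) φ.ex
  | all {n m : ℕ} {φ : arith.BoundedFormula α (m + 1)} :
      InHierarchy .pi (n + 1) φ → InHierarchy .pi (n + 1) φ.all

theorem InHierarchy.falsum {α : Type} (Γ : Side) (n : ℕ) {m : ℕ} :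
    InHierarchy Γ n (BoundedFormula.falsum : arith.BoundedFormula α m) := by
  induction n generalizing Γ with
  | zero => exact .bounded .falsum
  | succ n ih => exact .step (ih _)

theorem InHierarchy.neg {α : Type} {Γ : Side} {n m : ℕ} {φ : arith.BoundedFormula α m}
    (h : InHierarchy Γ.dual n φ) : InHierarchy Γ n φ.not := by
  cases n with
  | zero =>
    cases Γ <;> cases h with
    | bounded h => exact .bounded (.imp h .falsum)
  | succ n => exact .imp h (.falsum _ _)

theorem InHierarchy.sup {α : Type} {Γ : Side} {n m : ℕ} {φ ψ : arith.BoundedFormula α m}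
    (h₁ : InHierarchy Γ (n + 1) φ) (h₂ : InHierarchy Γ (n + 1) ψ) :
    InHierarchy Γ (n + 1) (φ ⊔ ψ) := by
  refine .imp (.neg ?_) h₂
  cases Γ <;> exact h₁

theorem InHierarchy.inf {α : Type} {Γ : Side} {n m : ℕ} {φ ψ : arith.BoundedFormula α m}
    (h₁ : InHierarchy Γ (n + 1) φ) (h₂ : InHierarchy Γ (n + 1) ψ) :
    InHierarchy Γ (n + 1) (φ ⊓ ψ) := by
  refine .neg (.imp ?_ (.neg ?_))
  · cases Γ <;> exact h₁
  · cases Γ <;> exact h₂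

/-! ### Gödel numbering -/

/-- The Gödel number of a term whose variables are among `x₀, …, xₘ₋₁`; sequences of length two
are coded by the pairing bijection `Nat.pair`. -/
def termCode {m : ℕ} : arith.Term (Empty ⊕ Fin m) → ℕ
  | .var (.inr i) => 5 * i
  | .func Func.zero _ => 1
  | .func Func.succ ts => 5 * termCode (ts 0) + 2
  | .func Func.add ts => 5 * Nat.pair (termCode (ts 0)) (termCode (ts 1)) + 3
  | .func Func.mul ts => 5 * Nat.pair (termCode (ts 0)) (termCode (ts 1)) + 4

/-- The Gödel number of a formula whose free variables are among `x₀, …, xₘ₋₁`. -/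
def formulaCode : {m : ℕ} → arith.BoundedFormula Empty m → ℕ
  | _, .falsum => 0
  | _, .equal t s => 5 * Nat.pair (termCode t) (termCode s) + 1
  | _, .rel Rel.le ts => 5 * Nat.pair (termCode (ts 0)) (termCode (ts 1)) + 2
  | _, .imp φ ψ => 5 * Nat.pair (formulaCode φ) (formulaCode ψ) + 3
  | _, .all φ => 5 * formulaCode φ + 4

/-- The Gödel number of a sentence. -/
def sentenceCode (φ : arith.Sentence) : ℕ := formulaCode φ

theorem termCode_injective {m : ℕ} :
    Function.Injective (termCode : arith.Term (Empty ⊕ Fin m) → ℕ) := by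
  intro t
  induction t with
  | var a =>
    intro s h
    rcases a with e | i
    · exact e.elim
    · cases s with
      | var b =>
        rcases b with e | j
        · exact e.elim
        · simp only [termCode] at h
          have : i = j := Fin.ext (by omega)
          rw [this]
      | func g us => cases g <;> simp only [termCode] at h <;> omega
  | func f ts ih =>
    intro s h
    cases s with
    | var b =>
      rcases b with e | j
      · exact e.elim
      · cases f <;> simp only [termCode] at h <;> omega
    | func g us =>
      cases f <;> cases g <;> simp only [termCode] at h <;> try omega
      · congr 1
        exact funext fun i => i.elim0
      · congr 1
        funext i
        fin_cases i
        exact ih 0 (Nat.eq_of_mul_eq_mul_left (by norm_num : 0 < 5) (Nat.add_right_cancel h))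
      all_goals
        obtain ⟨h₀, h₁⟩ := Nat.pair_eq_pair.1
          (Nat.eq_of_mul_eq_mul_left (by norm_num : 0 < 5) (Nat.add_right_cancel h))
        congr 1
        funext i
        fin_cases i
        · exact ih 0 h₀
        · exact ih 1 h₁

theorem formulaCode_injective {m : ℕ} :
    Function.Injective (formulaCode : arith.BoundedFormula Empty m → ℕ) := by
  intro φ
  induction φ with
  | falsum =>
    intro ψ h
    cases ψ with
    | falsum => rfl
    | rel r us => cases r; simp only [formulaCode] at h; omega
    | _ => simp only [formulaCode] at h; omega
  | equal t s =>
    intro ψ h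
    cases ψ with
    | equal t' s' =>
      simp only [formulaCode] at h
      obtain ⟨h₀, h₁⟩ := Nat.pair_eq_pair.1
          (Nat.eq_of_mul_eq_mul_left (by norm_num : 0 < 5) (Nat.add_right_cancel h))
      rw [termCode_injective h₀, termCode_injective h₁]
    | rel r us => cases r; simp only [formulaCode] at h; omega
    | _ => simp only [formulaCode] at h; omega
  | rel r ts =>
    intro ψ h
    cases r
    cases ψ with
    | rel r us =>
      cases r
      simp only [formulaCode] at h
      obtain ⟨h₀, h₁⟩ := Nat.pair_eq_pair.1
          (Nat.eq_of_mul_eq_mul_left (by norm_num : 0 < 5) (Nat.add_right_cancel h))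
      congr 1
      funext i
      fin_cases i
      · exact termCode_injective h₀
      · exact termCode_injective h₁
    | _ => simp only [formulaCode] at h; omega
  | imp φ₁ φ₂ ih₁ ih₂ =>
    intro ψ h
    cases ψ with
    | imp ψ₁ ψ₂ =>
      simp only [formulaCode] at h
      obtain ⟨h₀, h₁⟩ := Nat.pair_eq_pair.1
          (Nat.eq_of_mul_eq_mul_left (by norm_num : 0 < 5) (Nat.add_right_cancel h))
      rw [ih₁ h₀, ih₂ h₁]
    | rel r us => cases r; simp only [formulaCode] at h; omega
    | _ => simp only [formulaCode] at h; omega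
  | all φ ih =>
    intro ψ h
    cases ψ with
    | all ψ =>
      simp only [formulaCode] at h
      rw [ih (by omega : formulaCode φ = formulaCode ψ)]
    | rel r us => cases r; simp only [formulaCode] at h; omega
    | _ => simp only [formulaCode] at h; omega

/-! ### Definable theories and equivalence -/

/-- A theory, given by its set `T` of axioms, is `Σₙ`-definable (`Γ = .sigma`) or `Πₙ`-definable
(`Γ = .pi`) if some formula `A(x)` of that class with the only free variable `x` defines, in the
standard model, the set of Gödel numbers of axioms of `T`. -/
def IsDefinable (Γ : Side) (n : ℕ) (T : arith.Theory) : Prop :=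
  ∃ A : arith.Formula (Fin 1), InHierarchy Γ n A ∧
    {x : ℕ | A.Realize (fun _ : Fin 1 => x)} = sentenceCode '' T

/-- Two theories are equivalent if they have the same logical consequences. -/
def Equivalent (T T' : arith.Theory) : Prop :=
  ∀ φ : arith.Sentence, T ⊨ᵇ φ ↔ T' ⊨ᵇ φ

end Arithmetic

/-! This is Craig's trick, arranged so that it survives at level `n = 0`. The codes of the axioms of
`T` form a `Σₙ₊₁`-set, hence a projection `∃ y, Q x y` of a `Πₙ`-relation (`IsDef.isProj`). The
unbounded witness `y` is hidden inside the new axioms: each axiom `φ` is replaced by implications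
`vacuous j → φ`, where `vacuous j` is valid and its code bounds a witness. Valid premises do not
change the models (`equivalent_paddedTheory`). Membership of `z` among the new codes now needs only
quantifiers bounded by `z`, so it is `Πₙ` (`isDefinable_paddedTheory`).

For `n = 0` everything besides `Q` must be given by bounded formulas, without coding of sequences or
a graph of exponentiation. The premises are therefore chosen with codes `4 * 5 ^ j - 1`, and the
powers of the prime 5 have a bounded definition through their divisors. -/

namespace Arithmetic

/-! ### Arithmetical relations on the standard model -/

/-- The function `f` is the value of a term of arithmetic in the standard model. -/
def IsTermFun {k : ℕ} (f : (Fin k → ℕ) → ℕ) : Prop :=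
  ∃ t : arith.Term (Empty ⊕ Fin k), ∀ v, t.realize (Sum.elim default v) = f v

/-- The relation `P` is defined in the standard model by a formula of the given class. -/
def IsDef (Γ : Side) (n : ℕ) {k : ℕ} (P : (Fin k → ℕ) → Prop) : Prop :=
  ∃ φ : arith.BoundedFormula Empty k, InHierarchy Γ n φ ∧ ∀ v, φ.Realize default v ↔ P v

theorem realize_leFormula {α : Type} {m : ℕ} (t s : arith.Term (α ⊕ Fin m)) (v : α → ℕ)
    (xs : Fin m → ℕ) : (leFormula t s).Realize v xs ↔
      t.realize (Sum.elim v xs) ≤ s.realize (Sum.elim v xs) :=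
  Iff.rfl

theorem realize_lastLe {α : Type} {m : ℕ} (t : arith.Term (α ⊕ Fin m)) (v : α → ℕ)
    (xs : Fin m → ℕ) (x : ℕ) : (lastLe t).Realize v (Fin.snoc xs x) ↔
      x ≤ t.realize (Sum.elim v xs) := by
  rw [lastLe, realize_leFormula, Term.realize_relabel]
  have : (Sum.elim v (Fin.snoc xs x : Fin (m + 1) → ℕ)) ∘ Sum.map id Fin.castSucc
      = Sum.elim v xs := by
    funext i
    rcases i with i | i <;> simp
  rw [this]
  simp

theorem realize_ballLe {α : Type} {m : ℕ} (t : arith.Term (α ⊕ Fin m))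
    (φ : arith.BoundedFormula α (m + 1)) (v : α → ℕ) (xs : Fin m → ℕ) :
    (ballLe t φ).Realize v xs ↔
      ∀ x ≤ t.realize (Sum.elim v xs), φ.Realize v (Fin.snoc xs x) := by
  simp only [ballLe, BoundedFormula.realize_all, BoundedFormula.realize_imp, realize_lastLe]

theorem realize_bexLe {α : Type} {m : ℕ} (t : arith.Term (α ⊕ Fin m))
    (φ : arith.BoundedFormula α (m + 1)) (v : α → ℕ) (xs : Fin m → ℕ) :
    (bexLe t φ).Realize v xs ↔
      ∃ x ≤ t.realize (Sum.elim v xs), φ.Realize v (Fin.snoc xs x) := by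
  simp only [bexLe, BoundedFormula.realize_ex, BoundedFormula.realize_inf, realize_lastLe]

/-! ### Substitution of terms -/

section Substitution

variable {α β : Type}

/-- The assignment of values to variables given by a substitution. -/
def substVal {m m' : ℕ} (σ : α ⊕ Fin m → arith.Term (β ⊕ Fin m')) (v : β → ℕ)
    (xs : Fin m' → ℕ) (i : α ⊕ Fin m) : ℕ :=
  (σ i).realize (Sum.elim v xs)

/-- `φ'` is the result of the substitution `σ` in `φ`, up to equivalence in the standard model. -/
def IsSubst {m m' : ℕ} (σ : α ⊕ Fin m → arith.Term (β ⊕ Fin m'))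
    (φ : arith.BoundedFormula α m) (φ' : arith.BoundedFormula β m') : Prop :=
  ∀ v xs, φ'.Realize v xs ↔
    φ.Realize (fun a => substVal σ v xs (.inl a)) (fun i => substVal σ v xs (.inr i))

/-- The extension of a substitution under a quantifier. -/
def liftSubst {m m' : ℕ} (σ : α ⊕ Fin m → arith.Term (β ⊕ Fin m')) :
    α ⊕ Fin (m + 1) → arith.Term (β ⊕ Fin (m' + 1)) :=
  Sum.elim (fun a => (σ (.inl a)).relabel (Sum.map id Fin.castSucc))
    (Fin.snoc (fun i => (σ (.inr i)).relabel (Sum.map id Fin.castSucc))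
      (Term.var (.inr (Fin.last m'))))

theorem realize_relabel_castSucc {m : ℕ} (t : arith.Term (β ⊕ Fin m)) (v : β → ℕ)
    (xs : Fin m → ℕ) (x : ℕ) :
    (t.relabel (Sum.map id Fin.castSucc)).realize
      (Sum.elim v (Fin.snoc xs x : Fin (m + 1) → ℕ)) = t.realize (Sum.elim v xs) := by
  rw [Term.realize_relabel]
  congr 1
  funext i
  rcases i with i | i <;> simp

theorem substVal_liftSubst_inl {m m' : ℕ} (σ : α ⊕ Fin m → arith.Term (β ⊕ Fin m')) (v : β → ℕ)
    (xs : Fin m' → ℕ) (x : ℕ) (a : α) :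
    substVal (liftSubst σ) v (Fin.snoc xs x) (.inl a) = substVal σ v xs (.inl a) :=
  realize_relabel_castSucc _ _ _ _

theorem substVal_liftSubst_inr {m m' : ℕ} (σ : α ⊕ Fin m → arith.Term (β ⊕ Fin m')) (v : β → ℕ)
    (xs : Fin m' → ℕ) (x : ℕ) :
    (fun i => substVal (liftSubst σ) v (Fin.snoc xs x) (.inr i)) =
      (Fin.snoc (fun i => substVal σ v xs (.inr i)) x : Fin (m + 1) → ℕ) := by
  funext i
  refine Fin.lastCases ?_ (fun i => ?_) i
  · simp [substVal, liftSubst]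
  · simp only [substVal, liftSubst, Sum.elim_inr, Fin.snoc_castSucc]
    exact realize_relabel_castSucc _ _ _ _

theorem IsSubst.realize_snoc {m m' : ℕ} {σ : α ⊕ Fin m → arith.Term (β ⊕ Fin m')}
    {φ : arith.BoundedFormula α (m + 1)} {φ' : arith.BoundedFormula β (m' + 1)}
    (h : IsSubst (liftSubst σ) φ φ') (v : β → ℕ) (xs : Fin m' → ℕ) (x : ℕ) :
    φ'.Realize v (Fin.snoc xs x) ↔
      φ.Realize (fun a => substVal σ v xs (.inl a))
        (Fin.snoc (fun i => substVal σ v xs (.inr i)) x) := by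
  rw [h, substVal_liftSubst_inr]
  simp only [substVal_liftSubst_inl]

theorem realize_subst_term {m m' : ℕ} (σ : α ⊕ Fin m → arith.Term (β ⊕ Fin m'))
    (t : arith.Term (α ⊕ Fin m)) (v : β → ℕ) (xs : Fin m' → ℕ) :
    (t.subst σ).realize (Sum.elim v xs) = t.realize
      (Sum.elim (fun a => substVal σ v xs (.inl a)) (fun i => substVal σ v xs (.inr i))) := by
  rw [Term.realize_subst]
  congr 1
  funext i
  rcases i with i | i <;> rfl

theorem IsSubst.imp {m m' : ℕ} {σ : α ⊕ Fin m → arith.Term (β ⊕ Fin m')}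
    {φ ψ : arith.BoundedFormula α m} {φ' ψ' : arith.BoundedFormula β m'}
    (h : IsSubst σ φ φ') (h' : IsSubst σ ψ ψ') : IsSubst σ (φ.imp ψ) (φ'.imp ψ') := fun v xs => by
  rw [BoundedFormula.realize_imp, BoundedFormula.realize_imp, h, h']

theorem IsSubst.ball {m m' : ℕ} {σ : α ⊕ Fin m → arith.Term (β ⊕ Fin m')}
    {φ : arith.BoundedFormula α (m + 1)} {φ' : arith.BoundedFormula β (m' + 1)}
    (t : arith.Term (α ⊕ Fin m)) (h : IsSubst (liftSubst σ) φ φ') :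
    IsSubst σ (ballLe t φ) (ballLe (t.subst σ) φ') := fun v xs => by
  simp only [realize_ballLe, realize_subst_term, h.realize_snoc]

theorem IsSubst.bex {m m' : ℕ} {σ : α ⊕ Fin m → arith.Term (β ⊕ Fin m')}
    {φ : arith.BoundedFormula α (m + 1)} {φ' : arith.BoundedFormula β (m' + 1)}
    (t : arith.Term (α ⊕ Fin m)) (h : IsSubst (liftSubst σ) φ φ') :
    IsSubst σ (bexLe t φ) (bexLe (t.subst σ) φ') := fun v xs => by
  simp only [realize_bexLe, realize_subst_term, h.realize_snoc]

theorem IsSubst.ex {m m' : ℕ} {σ : α ⊕ Fin m → arith.Term (β ⊕ Fin m')}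
    {φ : arith.BoundedFormula α (m + 1)} {φ' : arith.BoundedFormula β (m' + 1)}
    (h : IsSubst (liftSubst σ) φ φ') : IsSubst σ φ.ex φ'.ex := fun v xs => by
  simp only [BoundedFormula.realize_ex, h.realize_snoc]

theorem IsSubst.all {m m' : ℕ} {σ : α ⊕ Fin m → arith.Term (β ⊕ Fin m')}
    {φ : arith.BoundedFormula α (m + 1)} {φ' : arith.BoundedFormula β (m' + 1)}
    (h : IsSubst (liftSubst σ) φ φ') : IsSubst σ φ.all φ'.all := fun v xs => by
  simp only [BoundedFormula.realize_all, h.realize_snoc]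

/-- Induction on the derivation of boundedness, not on the formula, rebuilds bounded quantifiers as
bounded quantifiers. Only truth in `ℕ` is tracked, which avoids syntactic identities for
substitution. -/
theorem IsBounded.exists_subst {m : ℕ} {φ : arith.BoundedFormula α m} (h : IsBounded φ) :
    ∀ {m' : ℕ} (σ : α ⊕ Fin m → arith.Term (β ⊕ Fin m')),
      ∃ φ' : arith.BoundedFormula β m', IsBounded φ' ∧ IsSubst σ φ φ' := by
  induction h with
  | falsum => exact fun σ => ⟨_, .falsum, fun _ _ => Iff.rfl⟩
  | equal t s =>
    refine fun σ => ⟨_, .equal (t.subst σ) (s.subst σ), fun v xs => ?_⟩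
    simp only [BoundedFormula.Realize, realize_subst_term]
  | le t s =>
    refine fun σ => ⟨_, .le (t.subst σ) (s.subst σ), fun v xs => ?_⟩
    simp only [realize_leFormula, realize_subst_term]
  | imp _ _ ih₁ ih₂ =>
    intro _ σ
    obtain ⟨φ', h₁, h₁'⟩ := ih₁ σ
    obtain ⟨ψ', h₂, h₂'⟩ := ih₂ σ
    exact ⟨_, h₁.imp h₂, h₁'.imp h₂'⟩
  | ball t _ ih =>
    intro _ σ
    obtain ⟨φ', h, h'⟩ := ih (liftSubst σ)
    exact ⟨_, h.ball _, h'.ball t⟩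
  | bex t _ ih =>
    intro _ σ
    obtain ⟨φ', h, h'⟩ := ih (liftSubst σ)
    exact ⟨_, h.bex _, h'.bex t⟩

theorem InHierarchy.exists_subst {Γ : Side} {n m : ℕ} {φ : arith.BoundedFormula α m}
    (h : InHierarchy Γ n φ) : ∀ {m' : ℕ} (σ : α ⊕ Fin m → arith.Term (β ⊕ Fin m')),
      ∃ φ' : arith.BoundedFormula β m', InHierarchy Γ n φ' ∧ IsSubst σ φ φ' := by
  induction h with
  | bounded h =>
    intro _ σ
    obtain ⟨φ', h, h'⟩ := h.exists_subst σ
    exact ⟨_, .bounded h, h'⟩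
  | step _ ih =>
    intro _ σ
    obtain ⟨φ', h, h'⟩ := ih σ
    exact ⟨_, .step h, h'⟩
  | imp _ _ ih₁ ih₂ =>
    intro _ σ
    obtain ⟨φ', h₁, h₁'⟩ := ih₁ σ
    obtain ⟨ψ', h₂, h₂'⟩ := ih₂ σ
    exact ⟨_, h₁.imp h₂, h₁'.imp h₂'⟩
  | ball t _ ih =>
    intro _ σ
    obtain ⟨φ', h, h'⟩ := ih (liftSubst σ)
    exact ⟨_, h.ball _, h'.ball t⟩
  | bex t _ ih =>
    intro _ σ
    obtain ⟨φ', h, h'⟩ := ih (liftSubst σ)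
    exact ⟨_, h.bex _, h'.bex t⟩
  | ex _ ih =>
    intro _ σ
    obtain ⟨φ', h, h'⟩ := ih (liftSubst σ)
    exact ⟨_, h.ex, h'.ex⟩
  | all _ ih =>
    intro _ σ
    obtain ⟨φ', h, h'⟩ := ih (liftSubst σ)
    exact ⟨_, h.all, h'.all⟩

end Substitution

/-! ### Closure properties -/

theorem InHierarchy.of_isBounded {α : Type} (Γ : Side) (n : ℕ) {m : ℕ}
    {φ : arith.BoundedFormula α m} (h : IsBounded φ) : InHierarchy Γ n φ := by
  induction n generalizing Γ with
  | zero => exact .bounded h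
  | succ n ih => exact .step (ih _)

theorem InHierarchy.isBounded {α : Type} {Γ : Side} {m : ℕ}
    {φ : arith.BoundedFormula α m} (h : InHierarchy Γ 0 φ) : IsBounded φ := by
  cases h with
  | bounded h => exact h

namespace IsTermFun

variable {k : ℕ} {f g : (Fin k → ℕ) → ℕ}

theorem proj (i : Fin k) : IsTermFun fun v => v i :=
  ⟨.var (.inr i), fun _ => rfl⟩

theorem add (hf : IsTermFun f) (hg : IsTermFun g) : IsTermFun fun v => f v + g v := by
  obtain ⟨t, ht⟩ := hf
  obtain ⟨s, hs⟩ := hg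
  refine ⟨.func (Func.add : arith.Functions 2) ![t, s], fun v => ?_⟩
  exact congrArg₂ _ (ht v) (hs v)

theorem mul (hf : IsTermFun f) (hg : IsTermFun g) : IsTermFun fun v => f v * g v := by
  obtain ⟨t, ht⟩ := hf
  obtain ⟨s, hs⟩ := hg
  refine ⟨.func (Func.mul : arith.Functions 2) ![t, s], fun v => ?_⟩
  exact congrArg₂ _ (ht v) (hs v)

theorem const (c : ℕ) : IsTermFun fun _ : Fin k → ℕ => c := by
  induction c with
  | zero => exact ⟨.func (Func.zero : arith.Functions 0) ![], fun _ => rfl⟩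
  | succ c ih =>
    obtain ⟨t, ht⟩ := ih
    refine ⟨.func (Func.succ : arith.Functions 1) ![t], fun v => ?_⟩
    exact congrArg (· + 1) (ht v)

theorem init (hf : IsTermFun f) : IsTermFun fun w : Fin (k + 1) → ℕ => f (Fin.init w) := by
  obtain ⟨t, ht⟩ := hf
  refine ⟨t.relabel (Sum.map id Fin.castSucc), fun w => ?_⟩
  conv_lhs => rw [← Fin.snoc_init_self w]
  rw [realize_relabel_castSucc, ht]

end IsTermFun

namespace IsDef

variable {Γ : Side} {n k : ℕ} {P Q : (Fin k → ℕ) → Prop} {f g : (Fin k → ℕ) → ℕ}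

theorem congr (hP : IsDef Γ n P) (h : ∀ v, P v ↔ Q v) : IsDef Γ n Q := by
  obtain ⟨φ, hφ, hφ'⟩ := hP
  exact ⟨φ, hφ, fun v => (hφ' v).trans (h v)⟩

theorem subst {l : ℕ} {R : (Fin l → ℕ) → Prop} (hR : IsDef Γ n R)
    {f : Fin l → (Fin k → ℕ) → ℕ} (hf : ∀ i, IsTermFun (f i)) :
    IsDef Γ n fun v => R fun i => f i v := by
  obtain ⟨φ, hφ, hφ'⟩ := hR
  choose t ht using hf
  obtain ⟨ψ, hψ, hψ'⟩ := hφ.exists_subst (Sum.elim Empty.elim t)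
  refine ⟨ψ, hψ, fun v => ?_⟩
  refine (hψ' _ _).trans ?_
  rw [Subsingleton.elim (fun a : Empty => _) default, hφ']
  simp only [substVal, Sum.elim_inr, ht]

theorem eq (hf : IsTermFun f) (hg : IsTermFun g) : IsDef Γ n fun v => f v = g v := by
  obtain ⟨t, ht⟩ := hf
  obtain ⟨s, hs⟩ := hg
  refine ⟨_, .of_isBounded Γ n (.equal t s), fun v => ?_⟩
  simp only [BoundedFormula.Realize, ht, hs]

theorem le (hf : IsTermFun f) (hg : IsTermFun g) : IsDef Γ n fun v => f v ≤ g v := by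
  obtain ⟨t, ht⟩ := hf
  obtain ⟨s, hs⟩ := hg
  refine ⟨_, .of_isBounded Γ n (.le t s), fun v => ?_⟩
  simp only [realize_leFormula, ht, hs]

theorem not (hP : IsDef Γ.dual n P) : IsDef Γ n fun v => ¬ P v := by
  obtain ⟨φ, hφ, hφ'⟩ := hP
  exact ⟨_, hφ.neg, fun v => by rw [BoundedFormula.realize_not, hφ']⟩

theorem or (hP : IsDef Γ n P) (hQ : IsDef Γ n Q) : IsDef Γ n fun v => P v ∨ Q v := by
  obtain ⟨φ, hφ, hφ'⟩ := hP
  obtain ⟨ψ, hψ, hψ'⟩ := hQ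
  refine ⟨φ ⊔ ψ, ?_, fun v => by rw [BoundedFormula.realize_sup, hφ', hψ']⟩
  -- The connective rules of the hierarchy begin at level 1; at level 0 the disjunction is unfolded
  -- into `→` and `⊥` inside the bounded formulas.
  cases n with
  | zero => exact .bounded (.imp (.imp hφ.isBounded .falsum) hψ.isBounded)
  | succ n => exact hφ.sup hψ

theorem and (hP : IsDef Γ n P) (hQ : IsDef Γ n Q) : IsDef Γ n fun v => P v ∧ Q v := by
  obtain ⟨φ, hφ, hφ'⟩ := hP
  obtain ⟨ψ, hψ, hψ'⟩ := hQ
  refine ⟨φ ⊓ ψ, ?_, fun v => by rw [BoundedFormula.realize_inf, hφ', hψ']⟩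
  cases n with
  | zero =>
    exact .bounded (.imp (.imp hφ.isBounded (.imp hψ.isBounded .falsum)) .falsum)
  | succ n => exact hφ.inf hψ

theorem ball {P : (Fin k → ℕ) → ℕ → Prop} (hf : IsTermFun f)
    (hP : IsDef Γ n fun w : Fin (k + 1) → ℕ => P (Fin.init w) (w (Fin.last k))) :
    IsDef Γ n fun v => ∀ x ≤ f v, P v x := by
  obtain ⟨φ, hφ, hφ'⟩ := hP
  obtain ⟨t, ht⟩ := hf
  refine ⟨ballLe t φ, ?_, fun v => by
    simp only [realize_ballLe, hφ', ht, Fin.init_snoc, Fin.snoc_last]⟩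
  cases n with
  | zero => exact .bounded (hφ.isBounded.ball t)
  | succ n => exact hφ.ball t

theorem bex {P : (Fin k → ℕ) → ℕ → Prop} (hf : IsTermFun f)
    (hP : IsDef Γ n fun w : Fin (k + 1) → ℕ => P (Fin.init w) (w (Fin.last k))) :
    IsDef Γ n fun v => ∃ x ≤ f v, P v x := by
  obtain ⟨φ, hφ, hφ'⟩ := hP
  obtain ⟨t, ht⟩ := hf
  refine ⟨bexLe t φ, ?_, fun v => by
    simp only [realize_bexLe, hφ', ht, Fin.init_snoc, Fin.snoc_last]⟩
  cases n with
  | zero => exact .bounded (hφ.isBounded.bex t)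
  | succ n => exact hφ.bex t

end IsDef

/-! ### Normal form of `Σₙ₊₁`-relations -/

/-- `P` is the projection of a `Πₙ`-relation. -/
def IsProj (n : ℕ) {k : ℕ} (P : (Fin k → ℕ) → Prop) : Prop :=
  ∃ Q : (Fin k → ℕ) → ℕ → Prop,
    (IsDef .pi n fun w : Fin (k + 1) → ℕ => Q (Fin.init w) (w (Fin.last k))) ∧
      ∀ v, P v ↔ ∃ y, Q v y

namespace IsProj

variable {n k : ℕ} {P P' : (Fin k → ℕ) → Prop}

theorem congr (hP : IsProj n P) (h : ∀ v, P v ↔ P' v) : IsProj n P' := by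
  obtain ⟨Q, hQ, hQ'⟩ := hP
  exact ⟨Q, hQ, fun v => (h v).symm.trans (hQ' v)⟩

theorem of_isDef (hP : IsDef .pi n P) : IsProj n P :=
  ⟨fun v _ => P v, hP.subst fun i => .proj i.castSucc, fun _ => by simp⟩

theorem or (hP : IsProj n P) (hP' : IsProj n P') : IsProj n fun v => P v ∨ P' v := by
  obtain ⟨Q, hQ, h⟩ := hP
  obtain ⟨Q', hQ', h'⟩ := hP'
  exact ⟨fun v y => Q v y ∨ Q' v y, hQ.or hQ', fun v => by simp only [h, h', exists_or]⟩

/-- Bookkeeping for variables: they may be permuted, identified, or joined by dummies. -/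
theorem isDef_comp {l : ℕ} {Q : (Fin k → ℕ) → ℕ → Prop}
    (hQ : IsDef .pi n fun w : Fin (k + 1) → ℕ => Q (Fin.init w) (w (Fin.last k)))
    (e : Fin k → Fin l) (j : Fin l) :
    IsDef .pi n fun w : Fin l → ℕ => Q (fun i => w (e i)) (w j) := by
  refine (hQ.subst (f := fun i w => w (Fin.snoc (α := fun _ => Fin l) e j i))
    fun i => .proj _).congr fun w => ?_
  have : (Fin.init fun i => w (Fin.snoc (α := fun _ => Fin l) e j i)) = fun i => w (e i) := by
    funext i
    simp [Fin.init]
  simp [this]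

/-- The matrix shared by `ex` and `ball`. The variables of `w` are the parameters, then the bound
`y`, then the quantified `x`; so `x` has to be moved past `y`. -/
theorem isDef_exists_le {Q : (Fin (k + 1) → ℕ) → ℕ → Prop}
    (hQ : IsDef .pi n fun w : Fin (k + 2) → ℕ => Q (Fin.init w) (w (Fin.last (k + 1)))) :
    IsDef .pi n fun w : Fin (k + 2) → ℕ => ∃ z ≤ w (Fin.last k).castSucc,
      Q (Fin.snoc (Fin.init (Fin.init w)) (w (Fin.last (k + 1)))) z := by
  refine IsDef.bex (.proj (Fin.last k).castSucc) ?_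
  refine (isDef_comp hQ (Fin.snoc (α := fun _ => Fin (k + 3))
    (fun i => i.castSucc.castSucc.castSucc)
    (Fin.last (k + 1)).castSucc) (Fin.last (k + 2))).congr fun w => ?_
  have : (fun i => w (Fin.snoc (α := fun _ => Fin (k + 3))
      (fun i => i.castSucc.castSucc.castSucc) (Fin.last (k + 1)).castSucc i)) =
      (Fin.snoc (Fin.init (Fin.init (Fin.init w))) (Fin.init w (Fin.last (k + 1))) :
        Fin (k + 1) → ℕ) := by
    funext i
    refine Fin.lastCases ?_ (fun i => ?_) i <;> simp [Fin.init]
  rw [this]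

/-- Two witnesses are merged into a common upper bound, and the bounded search below it stays within
`Πₙ`. -/
theorem and (hP : IsProj n P) (hP' : IsProj n P') : IsProj n fun v => P v ∧ P' v := by
  obtain ⟨Q, hQ, h⟩ := hP
  obtain ⟨Q', hQ', h'⟩ := hP'
  refine ⟨fun v y => (∃ z ≤ y, Q v z) ∧ ∃ z ≤ y, Q' v z, ?_, fun v => ?_⟩
  · exact (IsDef.bex (.proj _) (isDef_comp hQ (fun i => i.castSucc.castSucc) _)).and
      (IsDef.bex (.proj _) (isDef_comp hQ' (fun i => i.castSucc.castSucc) _))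
  · simp only [h, h']
    constructor
    · rintro ⟨⟨y, hy⟩, z, hz⟩
      exact ⟨max y z, ⟨y, le_max_left _ _, hy⟩, z, le_max_right _ _, hz⟩
    · rintro ⟨_, ⟨y, _, hy⟩, z, _, hz⟩
      exact ⟨⟨y, hy⟩, z, hz⟩

theorem ex {P : (Fin k → ℕ) → ℕ → Prop}
    (hP : IsProj n fun w : Fin (k + 1) → ℕ => P (Fin.init w) (w (Fin.last k))) :
    IsProj n fun v => ∃ x, P v x := by
  obtain ⟨Q, hQ, h⟩ := hP
  refine ⟨fun v y => ∃ x ≤ y, ∃ z ≤ y, Q (Fin.snoc v x) z, ?_, fun v => ?_⟩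
  · exact IsDef.bex (.proj (Fin.last k)) (isDef_exists_le hQ)
  · have h' : ∀ x, P v x ↔ ∃ y, Q (Fin.snoc v x) y := fun x => by
      simpa using h (Fin.snoc v x)
    simp only [h']
    constructor
    · rintro ⟨x, y, hy⟩
      exact ⟨max x y, x, le_max_left _ _, y, le_max_right _ _, hy⟩
    · rintro ⟨_, x, _, y, _, hy⟩
      exact ⟨x, y, hy⟩

theorem bex {P : (Fin k → ℕ) → ℕ → Prop} {f : (Fin k → ℕ) → ℕ} (hf : IsTermFun f)
    (hP : IsProj n fun w : Fin (k + 1) → ℕ => P (Fin.init w) (w (Fin.last k))) :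
    IsProj n fun v => ∃ x ≤ f v, P v x := by
  exact ex ((of_isDef (.le (.proj _) hf.init)).and hP)

/-- Collection in `ℕ`: only finitely many `x` are in question, so their witnesses have a common
bound, the supremum of a choice function. -/
theorem ball {P : (Fin k → ℕ) → ℕ → Prop} {f : (Fin k → ℕ) → ℕ} (hf : IsTermFun f)
    (hP : IsProj n fun w : Fin (k + 1) → ℕ => P (Fin.init w) (w (Fin.last k))) :
    IsProj n fun v => ∀ x ≤ f v, P v x := by
  obtain ⟨Q, hQ, h⟩ := hP
  refine ⟨fun v y => ∀ x ≤ f v, ∃ z ≤ y, Q (Fin.snoc v x) z, ?_, fun v => ?_⟩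
  · exact IsDef.ball hf.init (isDef_exists_le hQ)
  · have h' : ∀ x, P v x ↔ ∃ y, Q (Fin.snoc v x) y := fun x => by
      simpa using h (Fin.snoc v x)
    simp only [h']
    constructor
    · intro H
      choose! g hg using H
      exact ⟨(Finset.range (f v + 1)).sup g, fun x hx =>
        ⟨g x, Finset.le_sup (Finset.mem_range.2 (Nat.lt_succ_of_le hx)), hg x hx⟩⟩
    · rintro ⟨_, H⟩ x hx
      obtain ⟨z, _, hz⟩ := H x hx
      exact ⟨z, hz⟩

end IsProj

/-- Implication exchanges the two sides, so both are treated at once: a `Π`-formula is followed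
through its negation. Keeping the level as `N` with `N = n + 1` lets the induction run over all
constructors and discards `bounded`. -/
theorem InHierarchy.isProj {Γ : Side} {N k : ℕ} {φ : arith.BoundedFormula Empty k}
    (h : InHierarchy Γ N φ) : ∀ n, N = n + 1 →
      match Γ with
      | .sigma => IsProj n fun v => φ.Realize default v
      | .pi => IsProj n fun v => ¬ φ.Realize default v := by
  induction h with
  | bounded => intro n h; omega
  | @step Γ N _ φ h _ =>
    rintro n ⟨⟩
    have hφ : IsDef Γ.dual N fun v => φ.Realize default v := ⟨φ, h, fun _ => Iff.rfl⟩
    cases Γ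
    · exact .of_isDef hφ
    · exact .of_isDef (.not hφ)
  | @imp Γ N _ φ ψ _ _ ih₁ ih₂ =>
    rintro n ⟨⟩
    have h₁ := ih₁ _ rfl
    have h₂ := ih₂ _ rfl
    cases Γ
    · exact (h₁.or h₂).congr fun v => by rw [BoundedFormula.realize_imp, imp_iff_not_or]
    · exact (h₁.and h₂).congr fun v => by rw [BoundedFormula.realize_imp, Classical.not_imp]
  | @ball Γ N m t φ _ ih =>
    rintro n ⟨⟩
    have h := ih _ rfl
    cases Γ
    · exact (IsProj.ball (P := fun v x => φ.Realize default (Fin.snoc v x)) ⟨t, fun _ => rfl⟩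
        (h.congr fun w => by rw [Fin.snoc_init_self])).congr fun v => (realize_ballLe ..).symm
    · exact (IsProj.bex (P := fun v x => ¬ φ.Realize default (Fin.snoc v x)) ⟨t, fun _ => rfl⟩
        (h.congr fun w => by rw [Fin.snoc_init_self])).congr fun v => by
          rw [realize_ballLe]; push Not; rfl
  | @bex Γ N m t φ _ ih =>
    rintro n ⟨⟩
    have h := ih _ rfl
    cases Γ
    · exact (IsProj.bex (P := fun v x => φ.Realize default (Fin.snoc v x)) ⟨t, fun _ => rfl⟩
        (h.congr fun w => by rw [Fin.snoc_init_self])).congr fun v => (realize_bexLe ..).symm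
    · exact (IsProj.ball (P := fun v x => ¬ φ.Realize default (Fin.snoc v x)) ⟨t, fun _ => rfl⟩
        (h.congr fun w => by rw [Fin.snoc_init_self])).congr fun v => by
          rw [realize_bexLe]; push Not; rfl
  | @ex N m φ _ ih =>
    rintro n ⟨⟩
    exact (IsProj.ex (P := fun v x => φ.Realize default (Fin.snoc v x))
      ((ih _ rfl).congr fun w => by rw [Fin.snoc_init_self])).congr
        fun v => BoundedFormula.realize_ex.symm
  | @all N m φ _ ih =>
    rintro n ⟨⟩
    exact (IsProj.ex (P := fun v x => ¬ φ.Realize default (Fin.snoc v x))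
      ((ih _ rfl).congr fun w => by rw [Fin.snoc_init_self])).congr
        fun v => by rw [BoundedFormula.realize_all, not_forall]

theorem IsDef.isProj {n k : ℕ} {P : (Fin k → ℕ) → Prop} (h : IsDef .sigma (n + 1) P) :
    IsProj n P := by
  obtain ⟨φ, hφ, h'⟩ := h
  exact IsProj.congr (hφ.isProj n rfl) h'

/-! ### Padding -/

/-- The valid formula `∀ ⋯ ∀ (⊥ → ⊥)` with `k` quantifiers. -/
def vacuous : ℕ → {m : ℕ} → arith.BoundedFormula Empty m
  | 0, _ => .imp .falsum .falsum
  | k + 1, _ => (vacuous k).all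

theorem realize_vacuous {M : Type*} [arith.Structure M] (k : ℕ) {m : ℕ} (v : Empty → M)
    (xs : Fin m → M) : (vacuous k).Realize v xs := by
  induction k generalizing m with
  | zero => exact id
  | succ k ih => exact fun _ => ih _

/-- The base formula has code 3, and a quantifier sends `c` to `5 * c + 4`, that is, `c + 1` to `5 *
(c + 1)`. -/
theorem formulaCode_vacuous (k : ℕ) {m : ℕ} :
    formulaCode (vacuous k : arith.BoundedFormula Empty m) + 1 = 4 * 5 ^ k := by
  induction k generalizing m with
  | zero => rfl
  | succ k ih =>
    have := ih (m := m + 1)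
    simp only [vacuous, formulaCode, pow_succ]
    omega

/-- A positive number is a power of `p` exactly when each of its divisors other than 1 is a multiple
of `p`: a prime divisor must then be `p` itself. All quantifiers on the right are bounded by `m`, so
exponentiation is not needed. -/
theorem exists_eq_prime_pow_iff {p : ℕ} (hp : p.Prime) (m : ℕ) :
    (∃ k, m = p ^ k) ↔ 1 ≤ m ∧ ∀ d ≤ m, ∀ e ≤ m, ¬ m = d * e ∨ d = 1 ∨ ∃ c ≤ m, d = p * c := by
  constructor
  · rintro ⟨k, rfl⟩
    refine ⟨Nat.one_le_pow _ _ hp.pos, fun d hd e _ => ?_⟩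
    rw [or_iff_not_imp_left, not_not]
    intro h
    obtain ⟨j, _, rfl⟩ := (Nat.dvd_prime_pow hp).1 (Dvd.intro _ h.symm)
    cases j with
    | zero => exact .inl rfl
    | succ j =>
      exact .inr ⟨p ^ j, (Nat.pow_le_pow_right hp.pos j.le_succ).trans hd, pow_succ' p j⟩
  · rintro ⟨h, H⟩
    refine ⟨_, Nat.eq_prime_pow_of_unique_prime_dvd (p := p) (by omega) fun {q} hq hqm => ?_⟩
    obtain ⟨e, he⟩ := hqm
    have hle : q ≤ m ∧ e ≤ m := by
      constructor <;> refine Nat.le_of_dvd h ?_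
      · exact ⟨e, he⟩
      · exact ⟨q, he.trans (mul_comm _ _)⟩
    rcases H q hle.1 e hle.2 with h | h | ⟨c, _, hc⟩
    · exact (h he).elim
    · exact (hq.one_lt.ne' h).elim
    · exact ((Nat.prime_dvd_prime_iff_eq hp hq).1 ⟨c, hc⟩).symm

/-! ### Bounded definitions of the coding relations -/

section

variable {Γ : Side} {n k : ℕ} {f g h : (Fin k → ℕ) → ℕ}

theorem isDef_prime_pow {p : ℕ} (hp : p.Prime) :
    IsDef Γ n fun v : Fin 1 → ℕ => ∃ j, v 0 = p ^ j := by
  refine IsDef.congr ?_ fun v => (exists_eq_prime_pow_iff hp (v 0)).symm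
  refine .and (.le (.const 1) (.proj 0)) <| .ball (.proj 0) <| .ball (.proj 0) <|
    .or (.not (.eq (.proj 0) (.mul (.proj 1) (.proj 2)))) <|
    .or (.eq (.proj 1) (.const 1)) <| .bex (.proj 0) <|
    .eq (.proj 1) (.mul (.const p) (.proj 3))

theorem isDef_vacuous : IsDef Γ n fun v : Fin 1 → ℕ => ∃ j, v 0 + 1 = 4 * 5 ^ j := by
  refine IsDef.congr (P := fun v => ∃ m ≤ v 0, v 0 + 1 = 4 * m ∧ ∃ j, m = 5 ^ j) ?_ fun v => ?_
  · refine .bex (.proj 0) (.and (.eq (.add (.proj 0) (.const 1)) (.mul (.const 4) (.proj 1))) ?_)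
    exact (isDef_prime_pow Nat.prime_five).subst (f := fun _ w => w 1) fun _ => .proj 1
  · constructor
    · rintro ⟨_, _, h, j, rfl⟩
      exact ⟨j, h⟩
    · rintro ⟨j, h⟩
      exact ⟨5 ^ j, by omega, h, j, rfl⟩

/-- `Nat.pair` is a polynomial on each of two cases, so its graph needs no quantifiers. The outer `5
* _ + 3` is the code of an implication. -/
theorem isDef_pair (hf : IsTermFun f) (hg : IsTermFun g) (hh : IsTermFun h) :
    IsDef Γ n fun v => h v = 5 * Nat.pair (f v) (g v) + 3 := by
  refine IsDef.congr (P := fun v => (f v + 1 ≤ g v ∧ h v = 5 * (g v * g v + f v) + 3) ∨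
    (g v ≤ f v ∧ h v = 5 * (f v * f v + f v + g v) + 3)) ?_ fun v => ?_
  · exact .or
      (.and (.le (.add hf (.const 1)) hg)
        (.eq hh (.add (.mul (.const 5) (.add (.mul hg hg) hf)) (.const 3))))
      (.and (.le hg hf)
        (.eq hh (.add (.mul (.const 5) (.add (.add (.mul hf hf) hf) hg)) (.const 3))))
  · unfold Nat.pair
    split_ifs <;> omega

end

/-! ### Moving the variable of a defining formula between free and bound indices -/

theorem isDef_of_isDefinable {Γ : Side} {n : ℕ} {T : arith.Theory}
    (hT : IsDefinable Γ n T) :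
    IsDef Γ n fun v : Fin 1 → ℕ => v 0 ∈ sentenceCode '' T := by
  obtain ⟨A, hA, hA'⟩ := hT
  obtain ⟨φ, hφ, hφ'⟩ := hA.exists_subst (β := Empty) (m' := 1)
    (Sum.elim (fun _ => Term.var (.inr 0)) Fin.elim0)
  refine ⟨φ, hφ, fun v => ?_⟩
  refine (hφ' _ _).trans ?_
  simp only [← hA', Set.mem_ofPred_eq]
  rw [Formula.Realize, Subsingleton.elim (fun i : Fin 0 => _) (@default _ Unique.instInhabited)]
  rfl

theorem isDefinable_of_isDef {Γ : Side} {n : ℕ} {T : arith.Theory}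
    (hT : IsDef Γ n fun v : Fin 1 → ℕ => v 0 ∈ sentenceCode '' T) :
    IsDefinable Γ n T := by
  obtain ⟨φ, hφ, hφ'⟩ := hT
  obtain ⟨A, hA, hA'⟩ := hφ.exists_subst (β := Fin 1) (m' := 0)
    (Sum.elim Empty.elim (fun i => Term.var (.inl i)))
  refine ⟨A, hA, Set.ext fun x => ?_⟩
  refine (((hA' (fun _ => x) _).trans ?_).trans (hφ' fun _ => x) :)
  rw [Subsingleton.elim (fun a : Empty => _) default]
  rfl

/-! ### The padded theory -/

theorem equivalent_of_models_iff {T T' : arith.Theory}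
    (h : ∀ (M : Type) [arith.Structure M], M ⊨ T ↔ M ⊨ T') : Equivalent T T' := by
  intro φ
  constructor
  · intro H M
    have := (h M).2 M.is_model
    exact H (Theory.ModelType.of T M)
  · intro H M
    have := (h M).1 M.is_model
    exact H (Theory.ModelType.of T' M)

/-- The theory with axioms `vacuous j → φ`, where some `y` at most the Gödel number of the premise
witnesses that `φ` is to be an axiom. -/
def paddedTheory (Q : ℕ → ℕ → Prop) : arith.Theory :=
  {χ | ∃ (φ : arith.Sentence) (j : ℕ), χ = (vacuous j).imp φ ∧
    ∃ y ≤ formulaCode (vacuous j : arith.BoundedFormula Empty 0), Q (sentenceCode φ) y}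

/-- Both components of a pair are at most the pair, whence the bounds by `z`. By `hQ`, the relation
`Q` already forces `x` to be the code of a sentence, so syntax need not be arithmetized. -/
theorem mem_sentenceCode_paddedTheory {Q : ℕ → ℕ → Prop}
    (hQ : ∀ x y, Q x y → ∃ φ, sentenceCode φ = x) (z : ℕ) :
    z ∈ sentenceCode '' paddedTheory Q ↔ ∃ w ≤ z, ∃ x ≤ z, z = 5 * Nat.pair w x + 3 ∧
      (∃ j, w + 1 = 4 * 5 ^ j) ∧ ∃ y ≤ w, Q x y := by
  constructor
  · rintro ⟨_, ⟨φ, j, rfl, hy⟩, rfl⟩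
    have hl := Nat.left_le_pair (formulaCode (vacuous j : arith.BoundedFormula Empty 0))
      (sentenceCode φ)
    have hr := Nat.right_le_pair (formulaCode (vacuous j : arith.BoundedFormula Empty 0))
      (sentenceCode φ)
    have hz : sentenceCode ((vacuous j).imp φ) = 5 * Nat.pair
        (formulaCode (vacuous j : arith.BoundedFormula Empty 0)) (sentenceCode φ) + 3 := rfl
    exact ⟨_, by omega, _, by omega, hz, ⟨j, formulaCode_vacuous j⟩, hy⟩
  · rintro ⟨w, _, x, _, rfl, ⟨j, hj⟩, y, hy, hxy⟩
    obtain ⟨φ, rfl⟩ := hQ x y hxy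
    have hw : w = formulaCode (vacuous j : arith.BoundedFormula Empty 0) := by
      have := formulaCode_vacuous j (m := 0)
      omega
    subst hw
    exact ⟨_, ⟨φ, j, rfl, y, hy, hxy⟩, rfl⟩

theorem isDefinable_paddedTheory {n : ℕ} {Q : ℕ → ℕ → Prop}
    (hQ : ∀ x y, Q x y → ∃ φ, sentenceCode φ = x)
    (hQ' : IsDef .pi n fun v : Fin 2 → ℕ => Q (v 0) (v 1)) :
    IsDefinable .pi n (paddedTheory Q) := by
  refine isDefinable_of_isDef
    (IsDef.congr ?_ fun v => (mem_sentenceCode_paddedTheory hQ (v 0)).symm)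
  -- Variables 0, 1, 2, 3 stand for `z`, `w`, `x`, `y`.
  refine .bex (.proj 0) <| .bex (.proj 0) <|
    .and (isDef_pair (.proj 1) (.proj 2) (.proj 0)) <| .and ?_ <| .bex (.proj 1) ?_
  · exact isDef_vacuous.subst (f := fun _ w => w 1) fun _ => .proj 1
  · exact hQ'.subst (f := fun i w => w (![2, 3] i)) fun _ => .proj _

theorem equivalent_paddedTheory {T : arith.Theory} {Q : ℕ → ℕ → Prop}
    (hQ : ∀ x, x ∈ sentenceCode '' T ↔ ∃ y, Q x y) : Equivalent T (paddedTheory Q) := by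
  refine equivalent_of_models_iff fun M _ => ?_
  simp only [Theory.model_iff]
  constructor
  · rintro H _ ⟨φ, j, rfl, y, _, hy⟩ _
    obtain ⟨ψ, hψ, h⟩ := (hQ _).2 ⟨y, hy⟩
    -- The witness only shows that the code of `φ` is the code of some axiom `ψ`; injectivity of the
    -- coding gives `ψ = φ`.
    cases formulaCode_injective h
    exact H _ hψ
  · intro H φ hφ
    obtain ⟨y, hy⟩ := (hQ _).1 ⟨φ, hφ, rfl⟩
    -- Using `y` itself as the number of quantifiers suffices, since `y < 5 ^ y` gives `y ≤ 4 * 5 ^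
    -- y - 1`, the code of the premise.
    refine H ((vacuous y).imp φ) ⟨φ, y, rfl, y, ?_, hy⟩ (realize_vacuous _ _ _)
    have h₁ := formulaCode_vacuous y (m := 0)
    have h₂ : y < 5 ^ y := Nat.lt_pow_self (by norm_num)
    omega

end Arithmetic

open Arithmetic in
theorem exists_pi_definable_equivalent (n : ℕ) (T : arith.Theory)
    (hT : IsDefinable .sigma (n + 1) T) :
    ∃ T' : arith.Theory, IsDefinable .pi n T' ∧ Equivalent T T' := by
  obtain ⟨Q, hQ, h⟩ := (isDef_of_isDefinable hT).isProj
  have h' : ∀ x, x ∈ sentenceCode '' T ↔ ∃ y, Q (fun _ => x) y := fun x => h fun _ => x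
  refine ⟨paddedTheory fun x => Q fun _ => x,
    isDefinable_paddedTheory (fun x y hxy => ?_) (hQ.congr fun v => ?_),
    equivalent_paddedTheory h'⟩
  · obtain ⟨φ, _, hφ⟩ := (h' x).2 ⟨y, hxy⟩
    exact ⟨φ, hφ⟩
  · rw [show Fin.init v = fun _ => v 0 from funext fun i => by rw [Subsingleton.elim i 0]; rfl]
    rfl

theorem mainTheorem12 (n : ℕ) (T : Arithmetic.arith.Theory)
    (hT : Arithmetic.IsDefinable Arithmetic.Side.sigma (n + 1) T) :
    ∃ T' : Arithmetic.arith.Theory,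
      Arithmetic.IsDefinable Arithmetic.Side.pi n T' ∧ Arithmetic.Equivalent T T' :=
  exists_pi_definable_equivalent n T hT
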